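/- Let $\Gamma$ be a combinatorial map: a finite connected multigraph whose edges are partitioned into three classes $R$ (red), $G$ (green) and $B$ (black), each of which is a perfect matching, such that $R\cup G$ is a disjoint union of $4$-cycles. Let $V$, $E$ and $V^*$ be the sets of cycles of $R\cup B$, of $R\cup G$ and of $G\cup B$, respectively (two parallel edges form a cycle of length two). Let $(V,E)$ be the multigraph in which a vertex $v\in V$ and an edge $e\in E$ are incident if the cycles $v$ and $e$ share an edge of $\Gamma$ (so that $e$ is a loop if it shares edges with only one red-black cycle), and let $(V^*,E)$ be the multigraph defined in the same way from $V^*$ and $E$. A subset $F\subseteq E$ is called feasible if there is a Hamiltonian cycle $C$ of $\Gamma$ containing all black edges such that $F$ is the set of quadrilaterals $q\in E$ whose two green edges lie in $C$. Then the feasible sets are the feasible sets of a $\Delta$-matroid $D_\Gamma$ on $E$: there is at least one feasible set, and for all feasible $F_1,F_2$ and all $x\in F_1\mathbin{\triangle}F_2$ there is $y\in F_1\mathbin{\triangle}F_2$ (possibly $y=x$) such that $F_1\mathbin{\triangle}\{x,y\}$ is feasible. Moreover: 1. The lower matroid of $D_\Gamma$, that is, the matroid on $E$ whose bases are the feasible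 sets of least cardinality, is the cycle matroid of $(V,E)$, that is, the matroid on $E$ whose circuits are the edge sets of the cycles of $(V,E)$. 2. The upper matroid of $D_\Gamma$, that is, the matroid on $E$ whose bases are the feasible sets of largest cardinality, is the cocycle matroid of $(V^*,E)$, that is, the dual of the cycle matroid of $(V^*,E)$. -/

import Mathlib

/-- A `Δ`-matroid on the finite set (type) `E`: a nonempty collection of feasible subsets satisfying
the symmetric exchange axiom. -/
structure DeltaMatroid (E : Type*) [Finite E] where
  /-- The predicate singling out the feasible sets. -/
  Feasible : Set E → Prop
  exists_feasible : ∃ F, Feasible F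
  symm_exchange : ∀ F₁ F₂ : Set E, Feasible F₁ → Feasible F₂ → ∀ x ∈ symmDiff F₁ F₂,
    ∃ y ∈ symmDiff F₂ F₁, Feasible (symmDiff F₁ {x, y})

namespace DeltaMatroid

variable {E : Type*} [Finite E]

/-- `F` is a feasible set of least cardinality. -/
def IsLeast (D : DeltaMatroid E) (F : Set E) : Prop :=
  D.Feasible F ∧ ∀ F', D.Feasible F' → F.ncard ≤ F'.ncard

/-- `F` is a feasible set of largest cardinality. -/
def IsLargest (D : DeltaMatroid E) (F : Set E) : Prop :=
  D.Feasible F ∧ ∀ F', D.Feasible F' → F'.ncard ≤ F.ncard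

theorem exists_isLeast (D : DeltaMatroid E) : ∃ F, D.IsLeast F := by
  obtain ⟨F, hF, h⟩ := Set.exists_min_image {F | D.Feasible F} Set.ncard (Set.toFinite _)
    D.exists_feasible
  exact ⟨F, hF, h⟩

theorem exists_isLargest (D : DeltaMatroid E) : ∃ F, D.IsLargest F := by
  obtain ⟨F, hF, h⟩ := Set.exists_max_image {F | D.Feasible F} Set.ncard (Set.toFinite _)
    D.exists_feasible
  exact ⟨F, hF, h⟩

theorem isLeast_exchange (D : DeltaMatroid E) : Matroid.ExchangeProperty D.IsLeast := by
  rintro F₁ F₂ h₁ h₂ x ⟨hx₁, hx₂⟩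
  obtain ⟨y, hy, hF⟩ := D.symm_exchange F₁ F₂ h₁.1 h₂.1 x (Or.inl ⟨hx₁, hx₂⟩)
  have hy₁ : y ∉ F₁ := by
    intro hy₁
    have hss : symmDiff F₁ {x, y} ⊂ F₁ := by
      refine ⟨fun z hz ↦ ?_, fun h ↦ ?_⟩
      · simp only [Set.mem_symmDiff, Set.mem_insert_iff, Set.mem_singleton_iff] at hz
        grind
      · have := h hx₁
        simp [Set.mem_symmDiff, hx₁] at this
    exact absurd (h₁.2 _ hF) (not_le.2 (Set.ncard_lt_ncard hss))
  have hy₂ : y ∈ F₂ := by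
    rcases hy with h | h
    · exact h.1
    · exact absurd h.1 hy₁
  refine ⟨y, ⟨hy₂, hy₁⟩, ?_⟩
  have hF_eq : symmDiff F₁ {x, y} = insert y (F₁ \ {x}) := by
    ext z
    simp only [Set.mem_symmDiff, Set.mem_insert_iff, Set.mem_singleton_iff, Set.mem_sdiff]
    grind
  rw [hF_eq] at hF
  refine ⟨hF, fun F' hF' ↦ ?_⟩
  rw [Set.ncard_exchange hy₁ hx₁]
  exact h₁.2 F' hF'

/-- The `Δ`-matroid whose feasible sets are the complements of the feasible sets of `D`. -/
def dual (D : DeltaMatroid E) : DeltaMatroid E where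
  Feasible F := D.Feasible Fᶜ
  exists_feasible := by
    obtain ⟨F, hF⟩ := D.exists_feasible
    exact ⟨Fᶜ, by simpa using hF⟩
  symm_exchange F₁ F₂ h₁ h₂ x hx := by
    have key : ∀ A B : Set E, symmDiff Aᶜ Bᶜ = symmDiff A B := fun A B ↦ by
      ext z
      simp only [Set.mem_symmDiff, Set.mem_compl_iff]
      tauto
    have key' : ∀ A B : Set E, (symmDiff A B)ᶜ = symmDiff Aᶜ B := fun A B ↦ by
      ext z
      simp only [Set.mem_symmDiff, Set.mem_compl_iff]
      tauto
    obtain ⟨y, hy, hF⟩ := D.symm_exchange F₁ᶜ F₂ᶜ h₁ h₂ x (by rwa [key])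
    exact ⟨y, by rwa [key] at hy, by rwa [key']⟩

theorem dual_isLeast_iff (D : DeltaMatroid E) (F : Set E) : D.dual.IsLeast F ↔ D.IsLargest Fᶜ := by
  refine and_congr_right fun _ ↦ ⟨fun h F' hF' ↦ ?_, fun h F' hF' ↦ ?_⟩
  · have h' := h F'ᶜ (by simpa [dual] using hF')
    have := Set.ncard_add_ncard_compl F
    have := Set.ncard_add_ncard_compl F'
    omega
  · have h' := h F'ᶜ hF'
    have := Set.ncard_add_ncard_compl F
    have := Set.ncard_add_ncard_compl F'
    omega

/-- The lower matroid: its bases are the feasible sets of least cardinality. -/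
def lower (D : DeltaMatroid E) : Matroid E :=
  Matroid.ofIsBaseOfFinite (E := Set.univ) Set.finite_univ D.IsLeast D.exists_isLeast
    D.isLeast_exchange (fun _ _ ↦ Set.subset_univ _)

theorem isLargest_exchange (D : DeltaMatroid E) : Matroid.ExchangeProperty D.IsLargest := by
  have h : D.dual.lower✶.IsBase = D.IsLargest := by
    ext F
    rw [Matroid.dual_isBase_iff']
    simp [lower, dual_isLeast_iff, ← Set.compl_eq_univ_sdiff]
  exact h ▸ D.dual.lower✶.isBase_exchange

/-- The upper matroid: its bases are the feasible sets of largest cardinality. -/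
def upper (D : DeltaMatroid E) : Matroid E :=
  Matroid.ofIsBaseOfFinite (E := Set.univ) Set.finite_univ D.IsLargest D.exists_isLargest
    D.isLargest_exchange (fun _ _ ↦ Set.subset_univ _)

end DeltaMatroid

namespace Graph

/-- `C` is the edge set of a cycle of the multigraph `H`: a closed walk `v 0, e 0, v 1, …, e n, v 0`
(indices modulo `n + 1`) with distinct vertices and distinct edges. A loop is a cycle of length one,
and two parallel edges form a cycle of length two. -/
def IsCycleEdgeSet {α β : Type*} (H : Graph α β) (C : Set β) : Prop :=
  ∃ (n : ℕ) (v : Fin (n + 1) → α) (e : Fin (n + 1) → β), Function.Injective v ∧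
    Function.Injective e ∧ (∀ i, H.IsLink (e i) (v i) (v (i + 1))) ∧ Set.range e = C

end Graph

namespace Matroid

/-- `M` is the cycle matroid of the multigraph `H`: the matroid on the edge set of `H` whose
circuits are exactly the edge sets of the cycles of `H`. -/
def IsCycleMatroidOf {α β : Type*} (M : Matroid β) (H : Graph α β) : Prop :=
  M.E = H.edgeSet ∧ ∀ C, M.IsCircuit C ↔ H.IsCycleEdgeSet C

/-- `M` is the cocycle matroid of the multigraph `H`: the dual of its cycle matroid. -/
def IsCocycleMatroidOf {α β : Type*} (M : Matroid β) (H : Graph α β) : Prop :=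
  M✶.IsCycleMatroidOf H

end Matroid

/-- A combinatorial map (map graph) with vertex set `X`: a connected multigraph whose edges are
partitioned into red, green and black edges. Each colour class is a perfect matching, so it has no
two parallel edges and is recorded as a simple graph on `X`; edges of different colours may be
parallel, and the edge set of the multigraph is the disjoint union of the three edge sets. -/
structure CombinatorialMap (X : Type*) where
  /-- The red edges. -/
  R : SimpleGraph X
  /-- The green edges. -/
  G : SimpleGraph X
  /-- The black edges. -/
  B : SimpleGraph X
  red_matching : ∀ a, ∃! b, R.Adj a b
  green_matching : ∀ a, ∃! b, G.Adj a b
  black_matching : ∀ a, ∃! b, B.Adj a b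
  /-- The union of the red and the green edges is a disjoint union of 4-cycles. -/
  four_cycles : ∀ q : (R ⊔ G).ConnectedComponent,
    Nonempty (q.toSimpleGraph ≃g SimpleGraph.cycleGraph 4)
  connected : (R ⊔ G ⊔ B).Connected

namespace CombinatorialMap

variable {X : Type*}

/-- The set `V` of red-black cycles. The union of two perfect matchings is a disjoint union of
cycles (of length two if two edges are parallel), namely its connected components. -/
abbrev RedBlackCycle (Γ : CombinatorialMap X) : Type _ := (Γ.R ⊔ Γ.B).ConnectedComponent

/-- The set `V*` of green-black cycles. -/
abbrev GreenBlackCycle (Γ : CombinatorialMap X) : Type _ := (Γ.G ⊔ Γ.B).ConnectedComponent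

/-- The set `E` of red-green cycles, the quadrilaterals. -/
abbrev Quad (Γ : CombinatorialMap X) : Type _ := (Γ.R ⊔ Γ.G).ConnectedComponent

/-- The red-green cycle through `a`. -/
abbrev quad (Γ : CombinatorialMap X) (a : X) : Γ.Quad := (Γ.R ⊔ Γ.G).connectedComponentMk a

/-- The red-black cycle through `a`. -/
abbrev redBlack (Γ : CombinatorialMap X) (a : X) : Γ.RedBlackCycle :=
  (Γ.R ⊔ Γ.B).connectedComponentMk a

/-- The green-black cycle through `a`. -/
abbrev greenBlack (Γ : CombinatorialMap X) (a : X) : Γ.GreenBlackCycle :=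
  (Γ.G ⊔ Γ.B).connectedComponentMk a

/-- The subgraph of `Γ` with vertex set `X`, red edges `P`, green edges `Q` and all the black edges
of `Γ` is a (fully black) Hamiltonian cycle: it is 2-regular, where parallel edges of different
colours count separately, and connected. -/
structure IsFullyBlackHamiltonian (Γ : CombinatorialMap X) (P Q : SimpleGraph X) : Prop where
  red_le : P ≤ Γ.R
  green_le : Q ≤ Γ.G
  two_regular : ∀ a,
    (P.neighborSet a).ncard + (Q.neighborSet a).ncard + (Γ.B.neighborSet a).ncard = 2
  connected : (P ⊔ Q ⊔ Γ.B).Connected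

/-- `F` is the set of those quadrilaterals whose pair of green edges lies in some given fully black
Hamiltonian cycle. -/
def IsFeasible (Γ : CombinatorialMap X) (F : Set Γ.Quad) : Prop :=
  ∃ P Q : SimpleGraph X, Γ.IsFullyBlackHamiltonian P Q ∧
    F = {q | ∀ a b, Γ.G.Adj a b → Γ.quad a = q → Q.Adj a b}

/-- The red-black cycle `v` and the red-green cycle `q` share an edge (necessarily a red one). -/
def Incident (Γ : CombinatorialMap X) (q : Γ.Quad) (v : Γ.RedBlackCycle) : Prop :=
  ∃ a b, Γ.R.Adj a b ∧ Γ.quad a = q ∧ Γ.redBlack a = v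

/-- The green-black cycle `v` and the red-green cycle `q` share an edge (necessarily a green one). -/
def DualIncident (Γ : CombinatorialMap X) (q : Γ.Quad) (v : Γ.GreenBlackCycle) : Prop :=
  ∃ a b, Γ.G.Adj a b ∧ Γ.quad a = q ∧ Γ.greenBlack a = v

/-- The edges of one colour in a quadrilateral lie in at most two cycles (with the black edges). -/
theorem exists_pair {S P Q B : SimpleGraph X} (hS : S = P ⊔ Q) (hP : ∀ a, ∃! b, P.Adj a b)
    (hQ : ∀ a, ∃! b, Q.Adj a b)
    (h4 : ∀ q : S.ConnectedComponent, Nonempty (q.toSimpleGraph ≃g SimpleGraph.cycleGraph 4))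
    (q : S.ConnectedComponent) :
    ∃ x y, {v | ∃ a b, P.Adj a b ∧ S.connectedComponentMk a = q ∧
      (P ⊔ B).connectedComponentMk a = v} = {x, y} := by
  classical
  induction q using SimpleGraph.ConnectedComponent.ind with | _ a => ?_
  obtain ⟨d, had, hd⟩ := hQ a
  obtain ⟨p, hap, hp⟩ := hP a
  obtain ⟨r, hdr, hr⟩ := hP d
  obtain ⟨f⟩ := h4 (S.connectedComponentMk a)
  have hcard : (S.connectedComponentMk a).supp.ncard = 4 := by
    rw [← Nat.card_coe_set_eq]
    exact (Nat.card_congr f.toEquiv).trans (by simp)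
  have hfin : (S.connectedComponentMk a).supp.Finite :=
    Set.finite_of_ncard_ne_zero (by omega)
  have mem : ∀ z, S.connectedComponentMk z = S.connectedComponentMk a ↔
      z ∈ (S.connectedComponentMk a).supp := fun z ↦ Iff.rfl
  have sad : S.Adj a d := by rw [hS]; exact Or.inr had
  have sap : S.Adj a p := by rw [hS]; exact Or.inl hap
  have sdr : S.Adj d r := by rw [hS]; exact Or.inl hdr
  have hpd : p ≠ d := by
    rintro rfl
    have step : ∀ u v, S.Adj u v → v ∈ ({a, p} : Set X) → u ∈ ({a, p} : Set X) := by
      rintro u v huv hv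
      rw [hS] at huv
      rcases hv with rfl | rfl
      · rcases huv with h | h
        · exact Or.inr (hp _ h.symm)
        · exact Or.inr (hd _ h.symm)
      · rcases huv with h | h
        · exact Or.inl ((hP v).unique h.symm hap.symm)
        · exact Or.inl ((hQ v).unique h.symm had.symm)
    have walk : ∀ u v, S.Walk u v → v ∈ ({a, p} : Set X) → u ∈ ({a, p} : Set X) := by
      intro u v w
      induction w with
      | nil => exact id
      | cons huv _ ih => exact fun h ↦ step _ _ huv (ih h)
    have hsub : (S.connectedComponentMk a).supp ⊆ {a, p} := by
      intro z hz
      obtain ⟨w⟩ : S.Reachable z a := SimpleGraph.ConnectedComponent.exact hz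
      exact walk _ _ w (Or.inl rfl)
    have h1 := Set.ncard_le_ncard hsub (Set.toFinite _)
    have h2 := Set.ncard_pair had.ne
    omega
  have hpr : p ≠ r := by
    rintro rfl
    exact had.ne ((hP p).unique hap.symm hdr.symm)
  have har : a ≠ r := by
    rintro rfl
    exact hpd ((hP a).unique hap hdr.symm)
  have hset : ({a, p, d, r} : Set X) = (S.connectedComponentMk a).supp := by
    apply Set.eq_of_subset_of_ncard_le _ _ hfin
    · rintro z (rfl | rfl | rfl | rfl)
      · exact (mem _).1 rfl
      · exact (mem _).1 (SimpleGraph.ConnectedComponent.sound sap.symm.reachable)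
      · exact (mem _).1 (SimpleGraph.ConnectedComponent.sound sad.symm.reachable)
      · exact (mem _).1 (SimpleGraph.ConnectedComponent.sound
          (sdr.symm.reachable.trans sad.symm.reachable))
    · rw [hcard, Set.ncard_insert_of_notMem, Set.ncard_insert_of_notMem, Set.ncard_pair hdr.ne]
      · simp [hpd, hpr]
      · simp [hap.ne, had.ne, har]
  have bap : (P ⊔ B).connectedComponentMk p = (P ⊔ B).connectedComponentMk a :=
    SimpleGraph.ConnectedComponent.sound (SimpleGraph.Adj.reachable (Or.inl hap.symm))
  have bdr : (P ⊔ B).connectedComponentMk r = (P ⊔ B).connectedComponentMk d :=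
    SimpleGraph.ConnectedComponent.sound (SimpleGraph.Adj.reachable (Or.inl hdr.symm))
  refine ⟨(P ⊔ B).connectedComponentMk a, (P ⊔ B).connectedComponentMk d, ?_⟩
  ext v
  constructor
  · rintro ⟨z, b, -, hz, rfl⟩
    rw [mem, ← hset] at hz
    rcases hz with rfl | rfl | rfl | rfl
    · exact Or.inl rfl
    · exact Or.inl bap
    · exact Or.inr rfl
    · exact Or.inr bdr
  · rintro (rfl | rfl)
    · exact ⟨a, p, hap, rfl, rfl⟩
    · exact ⟨d, r, hdr, SimpleGraph.ConnectedComponent.sound sad.symm.reachable, rfl⟩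

/-- The multigraph `(V, E)` encoded by `Γ`: its vertices are the red-black cycles, its edges are the
red-green cycles, and the ends of an edge are the vertices it is incident with. -/
def graph (Γ : CombinatorialMap X) : Graph Γ.RedBlackCycle Γ.Quad where
  vertexSet := Set.univ
  edgeSet := Set.univ
  IsLink q x y := {v | Γ.Incident q v} = {x, y}
  isLink_symm _ _ := ⟨fun x y h ↦ h.trans (Set.pair_comm x y)⟩
  eq_or_eq_of_isLink_of_isLink q x y v w h h' := by
    have : x ∈ ({v, w} : Set _) := by rw [← h', h]; simp
    simpa using this
  edge_mem_iff_exists_isLink q := by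
    simpa only [Set.mem_univ, true_iff] using! exists_pair (B := Γ.B) rfl Γ.red_matching Γ.green_matching Γ.four_cycles q
  left_mem_of_isLink _ _ _ _ := Set.mem_univ _

/-- The geometric dual `(V*, E)`: its vertices are the green-black cycles, its edges are the
red-green cycles, and the ends of an edge are the vertices it is incident with. -/
def dualGraph (Γ : CombinatorialMap X) : Graph Γ.GreenBlackCycle Γ.Quad where
  vertexSet := Set.univ
  edgeSet := Set.univ
  IsLink q x y := {v | Γ.DualIncident q v} = {x, y}
  isLink_symm _ _ := ⟨fun x y h ↦ h.trans (Set.pair_comm x y)⟩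
  eq_or_eq_of_isLink_of_isLink q x y v w h h' := by
    have : x ∈ ({v, w} : Set _) := by rw [← h', h]; simp
    simpa using this
  edge_mem_iff_exists_isLink q := by
    simpa only [Set.mem_univ, true_iff] using! exists_pair (B := Γ.B) (sup_comm Γ.R Γ.G) Γ.green_matching Γ.red_matching Γ.four_cycles q
  left_mem_of_isLink _ _ _ _ := Set.mem_univ _

end CombinatorialMap

/-!
Write `m_F` for the matching that is green in the quadrilaterals of `F` and red in the others, so
that `F` is feasible if and only if the 2-factor formed by `m_F` and the black edges is connected.
Unions of components of this 2-factor are encoded as functions `φ : X → ZMod 2` invariant under both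
matchings (`FlagSystem.invariants`), and `F` is feasible if and only if only constants are invariant.

Everything rests on one parity argument (`FlagSystem.mem_invariants_of_splits`): if the
quadrilateral `e` meets two components of the 2-factor of `F`, then recolouring `e` merges them.

* Symmetric exchange: recolouring `x` in a Hamiltonian cycle leaves one component or two. If it
  leaves two, some `y` in the symmetric difference meets both, since the other feasible set is
  connected, and recolouring `y` merges them (`FlagSystem.Feasible.exchange`).
* Lower matroid: for `F = ∅` the invariant functions are the cuts of the graph on the red-black
  cycles. Forests and spanning edge sets are described through these cuts. A feasible set is
  spanning; by the parity argument, a spanning forest is feasible. A forest is never larger than a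
  spanning set, so the least feasible sets are the spanning trees (`FlagSystem.isLeast_iff`), and the
  independent sets of the lower matroid are the forests. Its circuits are the cycles because a cycle
  meets each cut in an even number of edges, a cycle minus an edge is a forest, and an edge set that
  is not a forest contains a cycle.
* Upper matroid: exchanging red and green complements the feasible sets, which reduces the claim to
  the one about the lower matroid.
-/

/-! ### Flag systems and invariant functions -/

/-- The flags of a combinatorial map (the vertices of the cubic graph) with its three matchings, each
recorded as a fixed-point-free involution, and the map sending a flag to its quadrilateral. -/
structure FlagSystem (X E : Type*) where
  /-- The other end of the red edge. -/
  r : X → X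
  /-- The other end of the green edge. -/
  g : X → X
  /-- The other end of the black edge. -/
  b : X → X
  /-- The quadrilateral through a flag. -/
  quad : X → E
  r_r : ∀ a, r (r a) = a
  g_g : ∀ a, g (g a) = a
  b_b : ∀ a, b (b a) = a
  r_ne : ∀ a, r a ≠ a
  g_ne : ∀ a, g a ≠ a
  b_ne : ∀ a, b a ≠ a
  r_g : ∀ a, r (g a) = g (r a)
  quad_eq_iff : ∀ a c, quad c = quad a ↔ c = a ∨ c = r a ∨ c = g a ∨ c = r (g a)
  quad_surjective : Function.Surjective quad
  /-- The three matchings together connect all flags: no union of components is proper. -/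
  connected : ∀ φ : X → ZMod 2, (∀ a, φ (r a) = φ a) → (∀ a, φ (g a) = φ a) →
    (∀ a, φ (b a) = φ a) → ∀ a c, φ a = φ c

namespace FlagSystem

variable {X E : Type*} (M : FlagSystem X E)

theorem quad_r (a : X) : M.quad (M.r a) = M.quad a := (M.quad_eq_iff _ _).2 (by simp)

theorem quad_g (a : X) : M.quad (M.g a) = M.quad a := (M.quad_eq_iff _ _).2 (by simp)

/-- The flag system of the geometric dual: red and green are exchanged. -/
def swap : FlagSystem X E where
  r := M.g
  g := M.r
  b := M.b
  quad := M.quad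
  r_r := M.g_g
  g_g := M.r_r
  b_b := M.b_b
  r_ne := M.g_ne
  g_ne := M.r_ne
  b_ne := M.b_ne
  r_g a := (M.r_g a).symm
  quad_eq_iff a c := by
    rw [M.quad_eq_iff, M.r_g]
    tauto
  quad_surjective := M.quad_surjective
  connected φ hr hg hb := M.connected φ hg hr hb

open Classical in
/-- The matching of the fully black 2-factor given by `F`, without its black edges: green in the
quadrilaterals of `F` and red in the others. -/
noncomputable def mate (F : Set E) (a : X) : X := if M.quad a ∈ F then M.g a else M.r a

variable {M} {F F' : Set E} {a c : X} {e : E}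

theorem mate_of_mem (h : M.quad a ∈ F) : M.mate F a = M.g a := if_pos h

theorem mate_of_notMem (h : M.quad a ∉ F) : M.mate F a = M.r a := if_neg h

theorem mate_empty : M.mate ∅ a = M.r a := mate_of_notMem (by simp)

theorem mate_congr (h : M.quad a ∈ F ↔ M.quad a ∈ F') : M.mate F a = M.mate F' a := by
  classical
  unfold mate
  by_cases h' : M.quad a ∈ F
  · rw [if_pos h', if_pos (h.1 h')]
  · rw [if_neg h', if_neg (mt h.2 h')]

theorem swap_mate_compl : M.swap.mate Fᶜ a = M.mate F a := by
  by_cases h : M.quad a ∈ F <;> simp [mate, h, swap]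

theorem quad_mate : M.quad (M.mate F a) = M.quad a := by
  unfold mate
  split_ifs
  exacts [M.quad_g a, M.quad_r a]

theorem mate_ne : M.mate F a ≠ a := by
  unfold mate
  split_ifs
  exacts [M.g_ne a, M.r_ne a]

theorem mate_mate : M.mate F (M.mate F a) = a := by
  by_cases h : M.quad a ∈ F
  · rw [mate_of_mem (a := M.mate F a) (by rwa [quad_mate]), mate_of_mem h, M.g_g]
  · rw [mate_of_notMem (a := M.mate F a) (by rwa [quad_mate]), mate_of_notMem h, M.r_r]

theorem quad_eq_iff_mate :
    M.quad c = M.quad a ↔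
      c = a ∨ c = M.mate F a ∨ c = M.mate Fᶜ a ∨ c = M.mate F (M.mate Fᶜ a) := by
  rw [M.quad_eq_iff]
  by_cases h : M.quad a ∈ F
  · rw [mate_of_mem h, mate_of_notMem (F := Fᶜ) (by simpa using h),
      mate_of_mem (a := M.r a) (by rwa [quad_r]), M.r_g]
    tauto
  · rw [mate_of_notMem h, mate_of_mem (F := Fᶜ) (by simpa using h),
      mate_of_notMem (a := M.g a) (by rwa [quad_g])]

/-- `φ` separates flags of the quadrilateral `e`. If `φ` comes from a set of red-black cycles,
this says that the edge `e` lies in the corresponding cut. -/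
def Splits (M : FlagSystem X E) (φ : X → ZMod 2) (e : E) : Prop :=
  ∃ a c, M.quad a = e ∧ M.quad c = e ∧ φ a ≠ φ c

/-- The functions that are constant on the components of the 2-factor given by `F`, that is, the
unions of components, with addition as symmetric difference. -/
def invariants (M : FlagSystem X E) (F : Set E) : Submodule (ZMod 2) (X → ZMod 2) where
  carrier := {φ | (∀ a, φ (M.b a) = φ a) ∧ ∀ a, φ (M.mate F a) = φ a}
  add_mem' h h' := ⟨fun a ↦ by simp [h.1 a, h'.1 a], fun a ↦ by simp [h.2 a, h'.2 a]⟩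
  zero_mem' := ⟨fun _ ↦ rfl, fun _ ↦ rfl⟩
  smul_mem' k _ h := ⟨fun a ↦ by simp [h.1 a], fun a ↦ by simp [h.2 a]⟩

/-- The 2-factor given by `F` is a Hamiltonian cycle. -/
def Feasible (M : FlagSystem X E) (F : Set E) : Prop :=
  ∀ φ ∈ M.invariants F, ∀ a c, φ a = φ c

variable {φ ψ : X → ZMod 2}

theorem swap_invariants_compl : M.swap.invariants Fᶜ = M.invariants F := by
  ext φ
  refine and_congr Iff.rfl (forall_congr' fun a ↦ ?_)
  rw [swap_mate_compl]

theorem splits_iff (hφ : φ ∈ M.invariants F) (ha : M.quad a = e) :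
    M.Splits φ e ↔ φ (M.mate Fᶜ a) ≠ φ a := by
  refine ⟨?_, fun h ↦ ⟨_, _, quad_mate.trans ha, ha, h⟩⟩
  rintro ⟨c, d, hc, hd, hne⟩ h
  have key : ∀ z, M.quad z = e → φ z = φ a := by
    intro z hz
    rcases (quad_eq_iff_mate (F := F)).1 (hz.trans ha.symm) with rfl | rfl | rfl | rfl
    · rfl
    · exact hφ.2 a
    · exact h
    · exact (hφ.2 _).trans h
  exact hne ((key c hc).trans (key d hd).symm)

theorem splits_add (hφ : φ ∈ M.invariants F) (hψ : ψ ∈ M.invariants F) :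
    M.Splits (φ + ψ) e ↔ ¬ (M.Splits φ e ↔ M.Splits ψ e) := by
  obtain ⟨a, ha⟩ := M.quad_surjective e
  rw [splits_iff (add_mem hφ hψ) ha, splits_iff hφ ha, splits_iff hψ ha, Pi.add_apply, Pi.add_apply]
  have : ∀ s t u v : ZMod 2, s + t ≠ u + v ↔ ¬ (s ≠ u ↔ t ≠ v) := by decide
  exact this _ _ _ _

theorem mem_invariants_of_not_splits (hφ : φ ∈ M.invariants F)
    (h : ∀ e ∈ symmDiff F F', ¬ M.Splits φ e) : φ ∈ M.invariants F' := by
  refine ⟨hφ.1, fun a ↦ ?_⟩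
  by_cases ha : M.quad a ∈ symmDiff F F'
  · by_contra hne
    exact h _ ha ⟨_, _, quad_mate, rfl, hne⟩
  · rw [← mate_congr (F := F), hφ.2 a]
    rw [Set.mem_symmDiff] at ha
    tauto

theorem not_splits_of_mem_invariants (hφ : φ ∈ M.invariants F) (hφ' : φ ∈ M.invariants F')
    (he : e ∈ symmDiff F F') : ¬ M.Splits φ e := by
  obtain ⟨a, rfl⟩ := M.quad_surjective e
  rw [splits_iff hφ rfl, not_not, ← mate_congr (F := F'), hφ'.2 a]
  rw [Set.mem_symmDiff] at he
  rw [Set.mem_compl_iff]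
  tauto

/-- A set closed under a fixed-point-free involution has even size. Applied with the two matchings
of a 2-factor, this replaces the fact that deleting an edge from a cycle leaves a path. -/
theorem even_card_of_involution [DecidableEq X] (S : Finset X) (m : X → X)
    (hm : ∀ a ∈ S, m a ∈ S) (hmm : ∀ a, m (m a) = a) (hne : ∀ a, m a ≠ a) : Even S.card := by
  have h : ∑ _a ∈ S, (1 : ZMod 2) = 0 :=
    Finset.sum_involution (fun a _ ↦ m a) (fun _ _ ↦ by decide) (fun a _ _ ↦ hne a)
      (fun a ha ↦ hm a ha) (fun a _ ↦ hmm a)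
  rw [Finset.sum_const, nsmul_one, ZMod.natCast_eq_zero_iff] at h
  exact even_iff_two_dvd.2 h

/-- If the quadrilateral `e` meets two components of the 2-factor given by `F`, then changing the
colour of its edges only merges components. -/
theorem mem_invariants_of_splits [Finite X] (hφ : φ ∈ M.invariants F) (he : M.Splits φ e)
    (hψ : ψ ∈ M.invariants (symmDiff F {e})) : ψ ∈ M.invariants F := by
  classical
  have := Fintype.ofFinite X
  refine ⟨hψ.1, fun a ↦ ?_⟩
  by_cases ha : M.quad a = e
  swap
  · rw [mate_congr (F' := symmDiff F {e}), hψ.2 a]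
    simp [Set.mem_symmDiff, ha]
  by_contra hne
  have hφa := (splits_iff hφ ha).1 he
  -- the flags in the `φ`-part and the `ψ`-part of `a`: closed under `b`, and without `a` also
  -- closed under `mate F`
  set S : Finset X := {z | φ z = φ a ∧ ψ z = ψ a} with hS
  have hmem : ∀ z, z ∈ S ↔ φ z = φ a ∧ ψ z = ψ a := fun z ↦ by simp [hS]
  have haS : a ∈ S := by simp [hmem]
  have h1 : Even S.card := even_card_of_involution S M.b
    (fun z hz ↦ by rw [hmem] at hz ⊢; rwa [hφ.1, hψ.1]) M.b_b M.b_ne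
  have h2 : Even (S.erase a).card := by
    refine even_card_of_involution _ (M.mate F) (fun z hz ↦ ?_) (fun _ ↦ mate_mate)
      (fun _ ↦ mate_ne)
    rw [Finset.mem_erase, hmem] at hz ⊢
    obtain ⟨hza, hz1, hz2⟩ := hz
    have hze : M.quad z ≠ e := by
      intro h
      rcases (quad_eq_iff_mate (F := F)).1 (h.trans ha.symm) with rfl | rfl | rfl | rfl
      · exact hza rfl
      · exact hne hz2
      · exact hφa hz1
      · exact hφa ((hφ.2 _).symm.trans hz1)
    refine ⟨fun h ↦ hze ?_, (hφ.2 z).trans hz1, ?_⟩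
    · rw [← ha, ← h, quad_mate]
    · rw [mate_congr (F' := symmDiff F {e}), hψ.2 z, hz2]
      simp [Set.mem_symmDiff, hze]
  rw [Finset.card_erase_of_mem haS] at h2
  have : 0 < S.card := Finset.card_pos.2 ⟨a, haS⟩
  grind

/-! ### The symmetric exchange axiom -/

theorem Feasible.exchange [Finite X] {F₁ F₂ : Set E} (h₁ : M.Feasible F₁) (h₂ : M.Feasible F₂)
    {x : E} (hx : x ∈ symmDiff F₁ F₂) :
    ∃ y ∈ symmDiff F₂ F₁, M.Feasible (symmDiff F₁ {x, y}) := by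
  by_cases hF : M.Feasible (symmDiff F₁ {x})
  · exact ⟨x, by rwa [symmDiff_comm], by rwa [Set.pair_eq_singleton]⟩
  -- `φ` is one of the two components into which the Hamiltonian cycle of `F₁` falls at `x`
  unfold Feasible at hF
  push Not at hF
  obtain ⟨φ, hφ, u, w, huw⟩ := hF
  have hback : ∀ χ ∈ M.invariants (symmDiff F₁ {x}), ¬ M.Splits χ x → ∀ a c, χ a = χ c := by
    intro χ hχ hs
    refine h₁ χ (mem_invariants_of_not_splits hχ fun e he ↦ ?_)
    rw [symmDiff_comm, symmDiff_symmDiff_cancel_left] at he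
    rwa [he]
  have hφx : M.Splits φ x := by
    by_contra h
    exact huw (hback φ hφ h u w)
  obtain ⟨y, hy, hyx, hφy⟩ : ∃ y ∈ symmDiff F₁ F₂, y ≠ x ∧ M.Splits φ y := by
    by_contra! h
    refine huw (h₂ φ (mem_invariants_of_not_splits hφ fun e he ↦ ?_) u w)
    have : e ∈ symmDiff F₁ F₂ ∧ e ≠ x := by
      simp only [Set.mem_symmDiff, Set.mem_singleton_iff] at he hx ⊢
      grind
    exact h e this.1 this.2
  refine ⟨y, by rwa [symmDiff_comm], fun ψ hψ ↦ ?_⟩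
  have heq : symmDiff F₁ {x, y} = symmDiff (symmDiff F₁ {x}) {y} := by
    ext z
    simp only [Set.mem_symmDiff, Set.mem_insert_iff, Set.mem_singleton_iff]
    grind
  rw [heq] at hψ
  have hψ' := mem_invariants_of_splits hφ hφy hψ
  have hψy : ¬ M.Splits ψ y := by
    refine not_splits_of_mem_invariants hψ' hψ ?_
    rw [symmDiff_symmDiff_cancel_left]
    rfl
  refine hback ψ hψ' fun hψx ↦ ?_
  have hconst := hback _ (add_mem hφ hψ') (by rw [splits_add hφ hψ']; tauto)
  have : M.Splits (φ + ψ) y := by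
    rw [splits_add hφ hψ']
    tauto
  obtain ⟨a, c, -, -, hac⟩ := this
  exact hac (hconst a c)

/-! ### Forests and spanning sets -/

/-- `I` is the edge set of a forest of the graph on the red-black cycles: each edge of `I` is the
only edge of `I` in some cut. -/
def IsForest (M : FlagSystem X E) (I : Set E) : Prop :=
  ∀ e ∈ I, ∃ φ ∈ M.invariants ∅, ∀ d ∈ I, M.Splits φ d ↔ d = e

/-- The edges in `F` connect all red-black cycles: each nontrivial cut meets `F`. -/
def IsSpanning (M : FlagSystem X E) (F : Set E) : Prop :=
  ∀ φ ∈ M.invariants ∅, (∀ d ∈ F, ¬ M.Splits φ d) → ∀ a c, φ a = φ c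

theorem isForest_empty : M.IsForest ∅ := fun _ h ↦ h.elim

theorem IsForest.subset {I J : Set E} (hJ : M.IsForest J) (h : I ⊆ J) : M.IsForest I := by
  intro e he
  obtain ⟨φ, hφ, hs⟩ := hJ e (h he)
  exact ⟨φ, hφ, fun d hd ↦ hs d (h hd)⟩

theorem isSpanning_univ : M.IsSpanning Set.univ := by
  intro φ hφ h
  refine M.connected φ (fun a ↦ by rw [← mate_empty (M := M), hφ.2 a]) (fun a ↦ ?_) hφ.1
  by_contra hne
  exact h _ trivial ⟨_, _, M.quad_g a, rfl, hne⟩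

theorem Feasible.isSpanning (h : M.Feasible F) : M.IsSpanning F := by
  intro φ hφ hs
  exact h φ (mem_invariants_of_not_splits hφ (by simpa [Set.mem_symmDiff] using hs))

/-- A forest glues red-black cycles together along its edges, never splitting a component. -/
theorem IsForest.invariants_le [Finite X] [Finite E] {I : Set E} (hI : M.IsForest I) :
    M.invariants I ≤ M.invariants ∅ := by
  induction I, I.toFinite using Set.Finite.induction_on with
  | empty => exact le_rfl
  | @insert e I he _ ih =>
    intro ψ hψ
    refine ih (hI.subset (Set.subset_insert e I)) ?_
    obtain ⟨φ, hφ, hs⟩ := hI e (Set.mem_insert e I)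
    have hφI : φ ∈ M.invariants I := mem_invariants_of_not_splits hφ fun d hd h ↦ by
      have hd' : d ∈ I := by simpa [Set.mem_symmDiff] using hd
      rw [hs d (Set.mem_insert_of_mem e hd')] at h
      exact he (h ▸ hd')
    refine mem_invariants_of_splits hφI ((hs e (Set.mem_insert e I)).2 rfl) ?_
    have : symmDiff I {e} = insert e I := by
      ext z
      simp only [Set.mem_symmDiff, Set.mem_singleton_iff, Set.mem_insert_iff]
      grind
    rwa [this]

theorem IsForest.feasible [Finite X] [Finite E] {I : Set E} (hI : M.IsForest I)
    (hs : M.IsSpanning I) : M.Feasible I := by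
  intro φ hφ
  refine hs φ (hI.invariants_le hφ) fun d hd ↦ ?_
  exact not_splits_of_mem_invariants (hI.invariants_le hφ) hφ (by simpa [Set.mem_symmDiff] using hd)

theorem IsForest.insert {I : Set E} (hI : M.IsForest I) (hφ : φ ∈ M.invariants ∅)
    (hφI : ∀ d ∈ I, ¬ M.Splits φ d) (he : M.Splits φ e) : M.IsForest (insert e I) := by
  rintro d (rfl | hd)
  · refine ⟨φ, hφ, ?_⟩
    rintro z (rfl | hz)
    · simpa using he
    · have := hφI z hz
      refine iff_of_false this ?_
      rintro rfl
      exact this he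
  · obtain ⟨χ, hχ, hs⟩ := hI d hd
    have hed : e ≠ d := fun h ↦ hφI d hd (h ▸ he)
    by_cases hχe : M.Splits χ e
    · refine ⟨χ + φ, add_mem hχ hφ, ?_⟩
      rintro z (rfl | hz)
      · rw [splits_add hχ hφ]
        tauto
      · rw [splits_add hχ hφ, ← hs z hz]
        have := hφI z hz
        tauto
    · refine ⟨χ, hχ, ?_⟩
      rintro z (rfl | hz)
      · tauto
      · exact hs z hz

theorem IsForest.exists_isSpanning [Finite E] {I : Set E} (hI : M.IsForest I) :
    ∃ T, I ⊆ T ∧ M.IsForest T ∧ M.IsSpanning T := by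
  obtain ⟨T, hIT, hT⟩ := (Set.toFinite {T : Set E | M.IsForest T}).exists_le_maximal hI
  refine ⟨T, hIT, hT.prop, fun φ hφ hs ↦ isSpanning_univ φ hφ fun d _ hd ↦ ?_⟩
  exact hs d (hT.le_of_ge (hT.prop.insert hφ hs hd) (Set.subset_insert d T)
    (Set.mem_insert d T)) hd

theorem IsSpanning.exists_isForest [Finite E] (hF : M.IsSpanning F) :
    ∃ T ⊆ F, M.IsForest T ∧ M.IsSpanning T := by
  obtain ⟨T, hTF, hT⟩ := (Set.toFinite {T : Set E | M.IsSpanning T}).exists_le_minimal hF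
  refine ⟨T, hTF, fun e he ↦ ?_, hT.prop⟩
  by_contra! h
  have : M.IsSpanning (T \ {e}) := by
    intro φ hφ hs
    refine hT.prop φ hφ fun d hd hd' ↦ ?_
    obtain ⟨z, hz, hz'⟩ := h φ hφ
    have hz0 : z ≠ e → ¬ M.Splits φ z := fun hze ↦ hs z ⟨hz, hze⟩
    have hd0 : d ≠ e → ¬ M.Splits φ d := fun hde ↦ hs d ⟨hd, hde⟩
    grind
  exact (hT.le_of_le this Set.sdiff_subset he).2 rfl

/-- The cuts isolating the edges of a forest are linearly independent, and a cut is determined up to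
complement by its edges in a spanning set. -/
theorem IsForest.ncard_le [Finite E] {I : Set E} (hI : M.IsForest I)
    (hF : M.IsSpanning F) : I.ncard ≤ F.ncard := by
  classical
  have := Fintype.ofFinite I
  choose! φ hφ hs using hI
  have hinv : ∀ x : I → ZMod 2, ∑ i, x i • φ i ∈ M.invariants ∅ := fun x ↦
    sum_mem fun i _ ↦ Submodule.smul_mem _ _ (hφ i i.2)
  let s := Function.surjInv M.quad_surjective
  have hs' : ∀ e, M.quad (s e) = e := Function.surjInv_eq _
  let J : (X → ZMod 2) → E → ZMod 2 := fun χ e ↦ χ (M.mate ∅ᶜ (s e)) - χ (s e)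
  have hJ : ∀ χ ∈ M.invariants ∅, ∀ e, J χ e = 0 ↔ ¬ M.Splits χ e := fun χ hχ e ↦ by
    rw [splits_iff hχ (hs' e), not_not, sub_eq_zero]
  let f : (I → ZMod 2) → F → ZMod 2 := fun x e ↦ J (∑ i, x i • φ i) e
  have hadd : ∀ (x y : I → ZMod 2) (e : E), J (∑ i, (x - y) i • φ i) e =
      J (∑ i, x i • φ i) e - J (∑ i, y i • φ i) e := fun x y e ↦ by
    simp only [J, Pi.sub_apply, sub_smul, Finset.sum_sub_distrib]
    abel
  have hdiag : ∀ (x : I → ZMod 2) (i : I), J (∑ i, x i • φ i) i = x i := by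
    intro x i
    have hJφ : ∀ j : I, J (φ j) i = if i = j then 1 else 0 := by
      intro j
      split_ifs with hij
      · have h1 := (hs j j.2 i i.2).2 (by rw [hij])
        have h2 := (hJ _ (hφ j j.2) i).not.2 (by rwa [not_not])
        have : ∀ z : ZMod 2, z ≠ 0 → z = 1 := by decide
        exact this _ h2
      · rw [hJ _ (hφ j j.2), hs j j.2 i i.2]
        exact fun h ↦ hij (Subtype.ext h)
    calc J (∑ j, x j • φ j) i = ∑ j, x j * J (φ j) i := by
          simp only [J, Finset.sum_apply, Pi.smul_apply, smul_eq_mul, mul_sub,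
            Finset.sum_sub_distrib]
      _ = x i := by simp [hJφ]
  have hinj : Function.Injective f := by
    intro x y hxy
    have hconst := hF _ (hinv (x - y)) fun d hd ↦ by
      rw [← hJ _ (hinv _), hadd, sub_eq_zero]
      exact congrFun hxy ⟨d, hd⟩
    ext i
    rw [← sub_eq_zero, ← Pi.sub_apply, ← hdiag (x - y) i]
    exact sub_eq_zero.2 (hconst _ _)
  have hcard := Nat.card_le_card_of_injective f hinj
  rw [Nat.card_fun, Nat.card_fun, Nat.card_zmod, Nat.card_coe_set_eq, Nat.card_coe_set_eq] at hcard
  exact (Nat.pow_le_pow_iff_right (by norm_num)).1 hcard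

theorem exists_feasible [Finite X] [Finite E] (M : FlagSystem X E) : ∃ F, M.Feasible F := by
  obtain ⟨T, -, hT, hT'⟩ := (isForest_empty (M := M)).exists_isSpanning
  exact ⟨T, hT.feasible hT'⟩

/-! ### The lower matroid -/

theorem isLeast_iff [Finite X] [Finite E] {D : DeltaMatroid E}
    (hD : ∀ F, D.Feasible F ↔ M.Feasible F) : D.IsLeast F ↔ M.IsForest F ∧ M.IsSpanning F := by
  constructor
  · rintro ⟨h, hmin⟩
    obtain ⟨T, hTF, hT, hT'⟩ := ((hD F).1 h).isSpanning.exists_isForest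
    have := hmin T ((hD T).2 (hT.feasible hT'))
    rw [← Set.eq_of_subset_of_ncard_le hTF this]
    exact ⟨hT, hT'⟩
  · rintro ⟨h, h'⟩
    exact ⟨(hD F).2 (h.feasible h'), fun F' hF' ↦ h.ncard_le ((hD F').1 hF').isSpanning⟩

theorem lower_indep_iff [Finite X] [Finite E] {D : DeltaMatroid E}
    (hD : ∀ F, D.Feasible F ↔ M.Feasible F) {I : Set E} : D.lower.Indep I ↔ M.IsForest I := by
  have hB : ∀ B, D.lower.IsBase B ↔ M.IsForest B ∧ M.IsSpanning B := fun B ↦ by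
    rw [← isLeast_iff hD]
    simp [DeltaMatroid.lower]
  rw [Matroid.indep_iff]
  constructor
  · rintro ⟨B, h, hIB⟩
    exact ((hB B).1 h).1.subset hIB
  · intro h
    obtain ⟨T, hIT, hT⟩ := h.exists_isSpanning
    exact ⟨T, (hB T).2 hT, hIT⟩

end FlagSystem

/-! ### Cycles of the graph -/

namespace FlagSystem

variable {X E α : Type*} {M : FlagSystem X E} {H : Graph α E} {v : X → α}

/-- `H` is the graph of red-black cycles of `M`, where `v a` is the red-black cycle through the flag
`a`: the functions on the vertices of `H` are the functions on the flags that are constant on the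
red-black cycles, and the ends of an edge `e` are those met by the quadrilateral `e`. -/
structure IsGraph (M : FlagSystem X E) (H : Graph α E) (v : X → α) : Prop where
  edgeSet_eq : H.edgeSet = Set.univ
  isLink_iff : ∀ a x y, H.IsLink (M.quad a) x y ↔ ({v a, v (M.g a)} : Set α) = {x, y}
  exists_eq_comp : ∀ φ ∈ M.invariants ∅, ∃ f : α → ZMod 2, φ = f ∘ v
  comp_mem : ∀ f : α → ZMod 2, f ∘ v ∈ M.invariants ∅

theorem IsGraph.splits_comp_iff (h : M.IsGraph H v) {e : E} {x y : α} (he : H.IsLink e x y)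
    (f : α → ZMod 2) : M.Splits (f ∘ v) e ↔ f x ≠ f y := by
  obtain ⟨a, rfl⟩ := M.quad_surjective e
  rw [h.isLink_iff, Set.pair_eq_pair_iff] at he
  rw [splits_iff (h.comp_mem f) rfl, mate_of_mem (by simp)]
  rcases he with ⟨rfl, rfl⟩ | ⟨rfl, rfl⟩
  · exact ne_comm
  · exact Iff.rfl

theorem IsGraph.exists_isLink (h : M.IsGraph H v) (e : E) : ∃ x y, H.IsLink e x y := by
  obtain ⟨a, rfl⟩ := M.quad_surjective e
  exact ⟨_, _, (h.isLink_iff a _ _).2 rfl⟩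

/-- Each cut meets a cycle in an even number of edges. -/
theorem IsGraph.not_isForest (h : M.IsGraph H v) {C : Set E} (hC : H.IsCycleEdgeSet C) :
    ¬ M.IsForest C := by
  obtain ⟨n, w, e, -, he, hl, rfl⟩ := hC
  intro hF
  obtain ⟨φ, hφ, hs⟩ := hF (e 0) ⟨0, rfl⟩
  obtain ⟨f, rfl⟩ := h.exists_eq_comp φ hφ
  have hs' : ∀ i, f (w (i + 1)) - f (w i) = if i = 0 then 1 else 0 := by
    intro i
    have h1 := hs (e i) ⟨i, rfl⟩
    rw [h.splits_comp_iff (hl i), he.eq_iff] at h1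
    have : ∀ s t : ZMod 2, s ≠ t → t - s = 1 := by decide
    split_ifs with hi
    · exact this _ _ (h1.2 hi)
    · rw [sub_eq_zero]
      by_contra hne
      exact hi (h1.1 (Ne.symm hne))
  have hsum : ∑ i, (f (w (i + 1)) - f (w i)) = 0 := by
    rw [Finset.sum_sub_distrib, sub_eq_zero]
    exact Equiv.sum_comp (Equiv.addRight (1 : Fin (n + 1))) fun i ↦ f (w i)
  simp [hs'] at hsum

/-- Removing an edge from a cycle leaves a path, whose initial segments give the required cuts. -/
theorem IsGraph.isForest_sdiff (h : M.IsGraph H v) {C : Set E} (hC : H.IsCycleEdgeSet C) {d : E}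
    (hd : d ∈ C) : M.IsForest (C \ {d}) := by
  classical
  obtain ⟨n, w, e, hw, he, hl, rfl⟩ := hC
  obtain ⟨k, rfl⟩ := hd
  rintro _ ⟨⟨i, rfl⟩, -⟩
  -- the path starts at `w (k + 1)`, so that `j - (k + 1)` is the position of `w j`
  let f : α → ZMod 2 := fun x ↦ if ∃ j, x = w j ∧ j - (k + 1) ≤ i - (k + 1) then 1 else 0
  have hf : ∀ j, f (w j) = if j - (k + 1) ≤ i - (k + 1) then 1 else 0 := by
    intro j
    simp [f, hw.eq_iff]
  refine ⟨f ∘ v, h.comp_mem f, ?_⟩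
  rintro _ ⟨⟨j, rfl⟩, hj⟩
  have hjk : j ≠ k := fun hjk ↦ hj (by rw [hjk]; rfl)
  rw [h.splits_comp_iff (hl j), hf, hf, he.eq_iff, add_sub_right_comm,
    ← sub_left_inj (a := k + 1) (b := j)]
  have hlast : j - (k + 1) < Fin.last n := by
    refine Fin.lt_last_iff_ne_last.2 fun hlast ↦ hjk ?_
    have : j - (k + 1) + 1 = 0 := by rw [hlast, Fin.last_add_one]
    rw [← sub_eq_zero, ← this]
    abel
  have hsucc := Fin.val_add_one_of_lt hlast
  generalize j - (k + 1) = p at *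
  generalize i - (k + 1) = q at *
  simp only [Fin.ext_iff, Fin.le_def, hsucc]
  split_ifs <;> simp <;> omega

theorem IsGraph.exists_isCycleEdgeSet (h : M.IsGraph H v) {C : Set E} (hC : ¬ M.IsForest C) :
    ∃ C' ⊆ C, H.IsCycleEdgeSet C' := by
  classical
  unfold IsForest at hC
  push Not at hC
  obtain ⟨e, he, hφ⟩ := hC
  obtain ⟨x, y, hxy⟩ := h.exists_isLink e
  let G : SimpleGraph α :=
    { Adj := fun s t ↦ s ≠ t ∧ ∃ d ∈ C, d ≠ e ∧ H.IsLink d s t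
      symm := ⟨fun s t ⟨hst, d, hd, hde, hl⟩ ↦ ⟨hst.symm, d, hd, hde, hl.symm⟩⟩
      loopless := ⟨fun s hs ↦ hs.1 rfl⟩ }
  -- the ends of `e` are connected in `C \ {e}`: no cut has `e` as its only edge in `C`
  have hreach : G.Reachable x y := by
    by_contra hr
    let f : α → ZMod 2 := fun z ↦ if G.Reachable x z then 1 else 0
    obtain ⟨d, hd, hds⟩ := hφ (f ∘ v) (h.comp_mem f)
    by_cases hde : d = e
    · subst hde
      rw [h.splits_comp_iff hxy] at hds
      simp [f, hr] at hds
    · obtain ⟨s, t, hst⟩ := h.exists_isLink d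
      rw [h.splits_comp_iff hst] at hds
      have hfst : f s ≠ f t := by tauto
      have hadj : G.Adj s t := ⟨fun hst' ↦ hfst (by rw [hst']), d, hd, hde, hst⟩
      have : G.Reachable x s ↔ G.Reachable x t :=
        ⟨fun h ↦ h.trans hadj.reachable, fun h ↦ h.trans hadj.symm.reachable⟩
      exact hfst (by simp [f, this])
  obtain ⟨p, hp⟩ := hreach.exists_isPath
  have hinj := hp.getVert_injOn
  have hstep : ∀ i, i < p.length → ∃ d ∈ C, d ≠ e ∧ H.IsLink d (p.getVert i) (p.getVert (i + 1)) :=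
    fun i hi ↦ (p.adj_getVert_succ hi).2
  have : Nonempty E := ⟨e⟩
  choose! c hcC hce hcl using hstep
  have hcinj : ∀ i j, i < p.length → j < p.length → c i = c j → i = j := by
    intro i j hi hj hij
    have h1 := hcl i hi
    rw [hij] at h1
    rcases h1.eq_and_eq_or_eq_and_eq (hcl j hj) with ⟨h2, -⟩ | ⟨h2, h3⟩
    · exact hinj hi.le hj.le h2
    · have h2' : i = j + 1 := hinj hi.le hj h2
      have h3' : i + 1 = j := hinj hi hj.le h3
      omega
  let q : Fin (p.length + 1) → E := fun i ↦ if i.1 < p.length then c i else e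
  refine ⟨Set.range q, ?_, p.length, fun i ↦ p.getVert i, q, ?_, ?_, ?_, rfl⟩
  · rintro _ ⟨i, rfl⟩
    dsimp only [q]
    split_ifs with hi
    exacts [hcC _ hi, he]
  · intro i j hij
    exact Fin.ext (hinj (Nat.lt_succ_iff.1 i.2) (Nat.lt_succ_iff.1 j.2) hij)
  · intro i j hij
    dsimp only [q] at hij
    split_ifs at hij with hi hj hj
    · exact Fin.ext (hcinj _ _ hi hj hij)
    · exact (hce _ hi hij).elim
    · exact (hce _ hj hij.symm).elim
    · exact Fin.ext (by omega)
  · intro i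
    dsimp only [q]
    split_ifs with hi
    · rw [Fin.val_add_one_of_lt (Fin.lt_def.2 hi)]
      exact hcl _ hi
    · have : i = Fin.last _ := Fin.ext (by simp; omega)
      subst this
      simpa using hxy.symm

theorem IsGraph.lower_isCycleMatroidOf [Finite X] [Finite E] (h : M.IsGraph H v)
    {D : DeltaMatroid E} (hD : ∀ F, D.Feasible F ↔ M.Feasible F) :
    D.lower.IsCycleMatroidOf H := by
  have hE : D.lower.E = Set.univ := rfl
  refine ⟨hE.trans h.edgeSet_eq.symm, ?_⟩
  have key : ∀ C, H.IsCycleEdgeSet C → D.lower.IsCircuit C := by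
    intro C hC
    rw [Matroid.isCircuit_iff_dep_forall_sdiff_singleton_indep]
    refine ⟨⟨fun hI ↦ h.not_isForest hC ((lower_indep_iff hD).1 hI), Set.subset_univ _⟩, ?_⟩
    exact fun d hd ↦ (lower_indep_iff hD).2 (h.isForest_sdiff hC hd)
  refine fun C ↦ ⟨fun hC ↦ ?_, key C⟩
  obtain ⟨C', hC'C, hC'⟩ := h.exists_isCycleEdgeSet (mt (lower_indep_iff hD).2 hC.dep.not_indep)
  rwa [← (key C' hC').eq_of_subset_isCircuit hC hC'C]

/-! ### The Δ-matroid -/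

/-- The `Δ`-matroid of a combinatorial map. -/
def deltaMatroid [Finite X] [Finite E] (M : FlagSystem X E) : DeltaMatroid E where
  Feasible := M.Feasible
  exists_feasible := M.exists_feasible
  symm_exchange _ _ h₁ h₂ _ hx := h₁.exchange h₂ hx

/-- Passing to the geometric dual complements the feasible sets, so it turns the largest ones into
the least ones. -/
theorem IsGraph.upper_isCocycleMatroidOf [Finite X] [Finite E] (h : M.swap.IsGraph H v) :
    M.deltaMatroid.upper.IsCocycleMatroidOf H := by
  have hdual : M.deltaMatroid.upper✶ = M.deltaMatroid.dual.lower := by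
    refine Matroid.ext_isBase rfl fun B _ ↦ ?_
    rw [Matroid.dual_isBase_iff']
    simp [DeltaMatroid.lower, DeltaMatroid.upper, DeltaMatroid.dual_isLeast_iff,
      ← Set.compl_eq_univ_sdiff]
  unfold Matroid.IsCocycleMatroidOf
  rw [hdual]
  refine h.lower_isCycleMatroidOf fun F ↦ ?_
  change M.Feasible Fᶜ ↔ _
  unfold Feasible
  rw [← swap_invariants_compl, compl_compl]

end FlagSystem

/-! ### The flag system of a combinatorial map -/

namespace SimpleGraph

variable {X : Type*} {S : SimpleGraph X}

theorem Reachable.apply_eq {β : Type*} {φ : X → β} (hφ : ∀ a c, S.Adj a c → φ a = φ c) {a c : X}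
    (h : S.Reachable a c) : φ a = φ c := by
  obtain ⟨p⟩ := h
  induction p with
  | nil => rfl
  | cons hadj _ ih => exact (hφ _ _ hadj).trans ih

theorem exists_eq_comp_connectedComponentMk {β : Type*} {φ : X → β}
    (hφ : ∀ a c, S.Adj a c → φ a = φ c) :
    ∃ f : S.ConnectedComponent → β, φ = f ∘ S.connectedComponentMk :=
  ⟨Quot.lift φ fun _ _ h ↦ Reachable.apply_eq hφ h, rfl⟩

theorem preconnected_of_forall
    (h : ∀ φ : X → ZMod 2, (∀ a c, S.Adj a c → φ a = φ c) → ∀ a c, φ a = φ c) :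
    S.Preconnected := by
  classical
  intro a c
  have := h (fun z ↦ if S.Reachable a z then 1 else 0) (fun s t hst ↦ ?_) a c
  · by_contra hac
    simp [hac] at this
  · have : S.Reachable a s ↔ S.Reachable a t :=
      ⟨fun h ↦ h.trans hst.reachable, fun h ↦ h.trans hst.symm.reachable⟩
    simp [this]

end SimpleGraph

namespace CombinatorialMap

variable {X : Type*}

theorem exists_adj_iff {S : SimpleGraph X} (hS : ∀ a, ∃! c, S.Adj a c) :
    ∃ m : X → X, (∀ a c, S.Adj a c ↔ c = m a) ∧ (∀ a, m (m a) = a) ∧ ∀ a, m a ≠ a := by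
  choose m hm hu using hS
  refine ⟨m, fun a c ↦ ⟨hu a c, fun h ↦ h ▸ hm a⟩, fun a ↦ (hu _ _ (hm a).symm).symm,
    fun a ↦ (hm a).ne'⟩

/-- The 4-cycle condition gives that red and green commute and that each quadrilateral has four
distinct flags. -/
theorem exists_flagSystem (Γ : CombinatorialMap X) :
    ∃ M : FlagSystem X Γ.Quad, M.quad = Γ.quad ∧ (∀ a c, Γ.R.Adj a c ↔ c = M.r a) ∧
      (∀ a c, Γ.G.Adj a c ↔ c = M.g a) ∧ ∀ a c, Γ.B.Adj a c ↔ c = M.b a := by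
  obtain ⟨r, hr, r_r, r_ne⟩ := exists_adj_iff Γ.red_matching
  obtain ⟨g, hg, g_g, g_ne⟩ := exists_adj_iff Γ.green_matching
  obtain ⟨b, hb, b_b, b_ne⟩ := exists_adj_iff Γ.black_matching
  have hadj : ∀ a c, (Γ.R ⊔ Γ.G).Adj a c ↔ c = r a ∨ c = g a := fun a c ↦ by
    rw [SimpleGraph.sup_adj, hr, hg]
  have quad_r : ∀ a, Γ.quad (r a) = Γ.quad a := fun a ↦
    SimpleGraph.ConnectedComponent.sound ((hadj _ _).2 (Or.inl (r_r a).symm)).reachable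
  have quad_g : ∀ a, Γ.quad (g a) = Γ.quad a := fun a ↦
    SimpleGraph.ConnectedComponent.sound ((hadj _ _).2 (Or.inr (g_g a).symm)).reachable
  have hcard : ∀ a, (Γ.quad a).supp.ncard = 4 := fun a ↦ by
    obtain ⟨f⟩ := Γ.four_cycles (Γ.quad a)
    rw [← Nat.card_coe_set_eq]
    exact (Nat.card_congr f.toEquiv).trans (by simp)
  have hne : ∀ a, r a ≠ g a := by
    intro a h
    have hsub : (Γ.quad a).supp ⊆ {a, r a} := by
      intro z hz
      have := SimpleGraph.Reachable.apply_eq (φ := fun z ↦ z = a ∨ z = r a) (S := Γ.R ⊔ Γ.G)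
        (fun s t hst ↦ by
          rw [hadj] at hst
          grind) (SimpleGraph.ConnectedComponent.exact hz)
      simp only [true_or, eq_iff_iff, iff_true] at this
      exact this
    have h1 := Set.ncard_le_ncard hsub (Set.toFinite _)
    have h2 := Set.ncard_pair (r_ne a).symm
    have := hcard a
    omega
  have hsupp : ∀ a, ({a, r a, g a, r (g a)} : Set X) = (Γ.quad a).supp := by
    intro a
    refine Set.eq_of_subset_of_ncard_le ?_ ?_ (Set.finite_of_ncard_ne_zero (by rw [hcard]; simp))
    · rintro z (rfl | rfl | rfl | rfl)
      exacts [rfl, quad_r a, quad_g a, (quad_r _).trans (quad_g a)]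
    · rw [hcard, Set.ncard_insert_of_notMem, Set.ncard_insert_of_notMem,
        Set.ncard_pair (r_ne _).symm]
      · simp only [Set.mem_insert_iff, Set.mem_singleton_iff]
        grind
      · simp only [Set.mem_insert_iff, Set.mem_singleton_iff]
        grind
  have hquad : ∀ a c, Γ.quad c = Γ.quad a ↔ c = a ∨ c = r a ∨ c = g a ∨ c = r (g a) := by
    intro a c
    change c ∈ (Γ.quad a).supp ↔ _
    rw [← hsupp]
    rfl
  refine ⟨⟨r, g, b, Γ.quad, r_r, g_g, b_b, r_ne, g_ne, b_ne, fun a ↦ ?_, hquad, ?_, ?_⟩,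
    rfl, hr, hg, hb⟩
  · have := (hquad a (g (r a))).1 ((quad_g _).trans (quad_r a))
    grind
  · exact Quot.mk_surjective
  · intro φ h1 h2 h3 a c
    refine SimpleGraph.Reachable.apply_eq (fun s t hst ↦ ?_) (Γ.connected.preconnected a c)
    rcases hst with (h | h) | h
    · rw [(hr s t).1 h, h1]
    · rw [(hg s t).1 h, h2]
    · rw [(hb s t).1 h, h3]

variable {Γ : CombinatorialMap X} {M : FlagSystem X Γ.Quad}

/-- In a fully black Hamiltonian cycle, the edges of a quadrilateral are both red or both green. -/
theorem IsFullyBlackHamiltonian.adj_green_congr {P Q : SimpleGraph X}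
    (h : Γ.IsFullyBlackHamiltonian P Q) (hr : ∀ a c, Γ.R.Adj a c ↔ c = M.r a)
    (hg : ∀ a c, Γ.G.Adj a c ↔ c = M.g a) (hb : ∀ a c, Γ.B.Adj a c ↔ c = M.b a) :
    (∀ a, P.Adj a (M.r a) ↔ ¬ Q.Adj a (M.g a)) ∧
      ∀ a c, M.quad c = M.quad a → Q.Adj a (M.g a) → Q.Adj c (M.g c) := by
  have hsub : ∀ {S T : SimpleGraph X} {m : X → X}, (∀ a c, S.Adj a c ↔ c = m a) → T ≤ S →
      ∀ a, (T.neighborSet a = {m a} ∧ T.Adj a (m a)) ∨ (T.neighborSet a = ∅ ∧ ¬ T.Adj a (m a)) := by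
    intro S T m hm hTS a
    have h1 : ∀ c, T.Adj a c → c = m a := fun c hc ↦ (hm a c).1 (hTS hc)
    by_cases h2 : T.Adj a (m a)
    · refine Or.inl ⟨?_, h2⟩
      ext c
      exact ⟨h1 c, fun hc ↦ by rw [Set.mem_singleton_iff.1 hc]; exact h2⟩
    · refine Or.inr ⟨?_, h2⟩
      ext c
      exact ⟨fun hc ↦ h2 (h1 c hc ▸ hc), fun hc ↦ hc.elim⟩
  have hiff : ∀ a, P.Adj a (M.r a) ↔ ¬ Q.Adj a (M.g a) := by
    intro a
    have h2 := h.two_regular a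
    have hB : Γ.B.neighborSet a = {M.b a} := by
      ext c
      exact hb a c
    rcases hsub hr h.red_le a with ⟨hP, hP'⟩ | ⟨hP, hP'⟩ <;>
    rcases hsub hg h.green_le a with ⟨hQ, hQ'⟩ | ⟨hQ, hQ'⟩ <;>
    simp [hP, hQ, hB, hP', hQ'] at h2 ⊢
  refine ⟨hiff, fun a c hac hQ ↦ ?_⟩
  have hgg : ∀ a, Q.Adj a (M.g a) → Q.Adj (M.g a) (M.g (M.g a)) := fun a ha ↦ by
    rw [M.g_g]
    exact ha.symm
  have hrr : ∀ a, Q.Adj a (M.g a) → Q.Adj (M.r a) (M.g (M.r a)) := fun a ha ↦ by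
    by_contra hn
    have := ((hiff _).2 hn).symm
    rw [M.r_r] at this
    exact (hiff a).1 this ha
  rcases (M.quad_eq_iff a c).1 hac with rfl | rfl | rfl | rfl
  exacts [hQ, hrr _ hQ, hgg _ hQ, hrr _ (hgg _ hQ)]

theorem isFeasible_iff (hquad : M.quad = Γ.quad) (hr : ∀ a c, Γ.R.Adj a c ↔ c = M.r a)
    (hg : ∀ a c, Γ.G.Adj a c ↔ c = M.g a) (hb : ∀ a c, Γ.B.Adj a c ↔ c = M.b a)
    (F : Set Γ.Quad) : Γ.IsFeasible F ↔ M.Feasible F := by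
  constructor
  · rintro ⟨P, Q, h, hF⟩
    obtain ⟨hPQ, hcongr⟩ := h.adj_green_congr hr hg hb
    have hmem : ∀ a, M.quad a ∈ F ↔ Q.Adj a (M.g a) := by
      intro a
      rw [hF, Set.mem_ofPred_eq]
      refine ⟨fun ha ↦ ha a _ ((hg _ _).2 rfl) (by rw [hquad]), fun ha c d hcd hc ↦ ?_⟩
      rw [(hg c d).1 hcd]
      exact hcongr a c (by rw [← hc, hquad]) ha
    intro φ hφ a c
    refine SimpleGraph.Reachable.apply_eq (fun s t hst ↦ ?_) (h.connected.preconnected a c)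
    rcases hst with (hst | hst) | hst
    · have ht := (hr s t).1 (h.red_le hst)
      subst ht
      rw [← hφ.2 s, FlagSystem.mate_of_notMem]
      rwa [hmem, ← hPQ]
    · have ht := (hg s t).1 (h.green_le hst)
      subst ht
      rw [← hφ.2 s, FlagSystem.mate_of_mem]
      rwa [hmem]
    · rw [(hb s t).1 hst, hφ.1]
  · intro h
    have hquadR : ∀ {a c}, Γ.R.Adj a c → M.quad a = M.quad c := fun hac ↦ by
      rw [(hr _ _).1 hac, M.quad_r]
    have hquadG : ∀ {a c}, Γ.G.Adj a c → M.quad a = M.quad c := fun hac ↦ by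
      rw [(hg _ _).1 hac, M.quad_g]
    let P : SimpleGraph X :=
      { Adj := fun a c ↦ Γ.R.Adj a c ∧ M.quad a ∉ F
        symm := ⟨fun a c hac ↦ ⟨hac.1.symm, hquadR hac.1 ▸ hac.2⟩⟩
        loopless := ⟨fun a ha ↦ Γ.R.irrefl ha.1⟩ }
    let Q : SimpleGraph X :=
      { Adj := fun a c ↦ Γ.G.Adj a c ∧ M.quad a ∈ F
        symm := ⟨fun a c hac ↦ ⟨hac.1.symm, hquadG hac.1 ▸ hac.2⟩⟩
        loopless := ⟨fun a ha ↦ Γ.G.irrefl ha.1⟩ }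
    refine ⟨P, Q, ⟨fun _ _ h ↦ h.1, fun _ _ h ↦ h.1, fun a ↦ ?_, ?_⟩, ?_⟩
    · have hB : Γ.B.neighborSet a = {M.b a} := by
        ext c
        exact hb a c
      by_cases ha : M.quad a ∈ F
      · have hP : P.neighborSet a = ∅ := by
          ext c
          simp [P, ha]
        have hQ : Q.neighborSet a = {M.g a} := by
          ext c
          simp [Q, ha, hg]
        simp [hP, hQ, hB]
      · have hP : P.neighborSet a = {M.r a} := by
          ext c
          simp [P, ha, hr]
        have hQ : Q.neighborSet a = ∅ := by
          ext c
          simp [Q, ha]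
        simp [hP, hQ, hB]
    · have := Γ.connected.nonempty
      refine ⟨SimpleGraph.preconnected_of_forall fun φ hφ ↦ h φ ⟨fun a ↦ ?_, fun a ↦ ?_⟩⟩
      · exact (hφ _ _ (Or.inr ((hb _ _).2 rfl))).symm
      · by_cases ha : M.quad a ∈ F
        · rw [FlagSystem.mate_of_mem ha]
          exact (hφ _ _ (Or.inl (Or.inr ⟨(hg _ _).2 rfl, ha⟩))).symm
        · rw [FlagSystem.mate_of_notMem ha]
          exact (hφ _ _ (Or.inl (Or.inl ⟨(hr _ _).2 rfl, ha⟩))).symm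
    · ext q
      obtain ⟨a, rfl⟩ := M.quad_surjective q
      rw [Set.mem_ofPred_eq]
      refine ⟨fun ha c d hcd hc ↦ ⟨hcd, ?_⟩, fun ha ↦ ?_⟩
      · rwa [hquad, hc]
      · exact (ha a (M.g a) ((hg _ _).2 rfl) (by rw [hquad])).2

/-- The vertices met by the quadrilateral of `a`, when `v` sends a flag to its vertex: red edges stay
within a vertex, so two of the four flags suffice. -/
theorem incident_eq_pair {α : Type*} {S : SimpleGraph X} {v : X → α}
    (hS : ∀ a, ∃ c, S.Adj a c) (hvr : ∀ a, v (M.r a) = v a) (a : X) :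
    {x | ∃ c d, S.Adj c d ∧ M.quad c = M.quad a ∧ v c = x} = {v a, v (M.g a)} := by
  ext x
  simp only [Set.mem_ofPred_eq, Set.mem_insert_iff, Set.mem_singleton_iff]
  constructor
  · rintro ⟨c, d, -, hc, rfl⟩
    rcases (M.quad_eq_iff a c).1 hc with rfl | rfl | rfl | rfl <;> simp [hvr]
  · rintro (rfl | rfl)
    · obtain ⟨d, hd⟩ := hS a
      exact ⟨a, d, hd, rfl, rfl⟩
    · obtain ⟨d, hd⟩ := hS (M.g a)
      exact ⟨_, d, hd, M.quad_g a, rfl⟩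

theorem comp_connectedComponentMk_mem {S T : SimpleGraph X} (hr : ∀ a c, S.Adj a c ↔ c = M.r a)
    (hb : ∀ a c, T.Adj a c ↔ c = M.b a) (f : (S ⊔ T).ConnectedComponent → ZMod 2) :
    f ∘ (S ⊔ T).connectedComponentMk ∈ M.invariants ∅ := by
  refine ⟨fun a ↦ congrArg f ?_, fun a ↦ congrArg f ?_⟩
  · exact SimpleGraph.ConnectedComponent.sound
      (SimpleGraph.Adj.reachable (Or.inr ((hb _ _).2 rfl))).symm
  · rw [FlagSystem.mate_empty]
    exact SimpleGraph.ConnectedComponent.sound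
      (SimpleGraph.Adj.reachable (Or.inl ((hr _ _).2 rfl))).symm

theorem exists_eq_comp_of_mem {S T : SimpleGraph X} (hr : ∀ a c, S.Adj a c ↔ c = M.r a)
    (hb : ∀ a c, T.Adj a c ↔ c = M.b a) {φ : X → ZMod 2} (hφ : φ ∈ M.invariants ∅) :
    ∃ f : (S ⊔ T).ConnectedComponent → ZMod 2, φ = f ∘ (S ⊔ T).connectedComponentMk := by
  refine SimpleGraph.exists_eq_comp_connectedComponentMk fun a c hac ↦ ?_
  rcases hac with hac | hac
  · rw [(hr a c).1 hac, ← FlagSystem.mate_empty (M := M), hφ.2]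
  · rw [(hb a c).1 hac, hφ.1]

theorem connectedComponentMk_r {S T : SimpleGraph X} (hr : ∀ a c, S.Adj a c ↔ c = M.r a) (a : X) :
    (S ⊔ T).connectedComponentMk (M.r a) = (S ⊔ T).connectedComponentMk a :=
  SimpleGraph.ConnectedComponent.sound
    (SimpleGraph.Adj.reachable (Or.inl ((hr _ _).2 rfl))).symm

theorem isGraph_graph (hquad : M.quad = Γ.quad) (hr : ∀ a c, Γ.R.Adj a c ↔ c = M.r a)
    (hb : ∀ a c, Γ.B.Adj a c ↔ c = M.b a) : M.IsGraph Γ.graph Γ.redBlack where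
  edgeSet_eq := rfl
  isLink_iff a x y := by
    rw [← incident_eq_pair (S := Γ.R) (fun a ↦ ⟨_, (hr a _).2 rfl⟩) (connectedComponentMk_r hr) a,
      hquad]
    rfl
  exists_eq_comp _ hφ := exists_eq_comp_of_mem hr hb hφ
  comp_mem f := comp_connectedComponentMk_mem hr hb f

theorem isGraph_dualGraph (hquad : M.quad = Γ.quad) (hg : ∀ a c, Γ.G.Adj a c ↔ c = M.g a)
    (hb : ∀ a c, Γ.B.Adj a c ↔ c = M.b a) : M.swap.IsGraph Γ.dualGraph Γ.greenBlack where
  edgeSet_eq := rfl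
  isLink_iff a x y := by
    rw [← incident_eq_pair (M := M.swap) (S := Γ.G) (fun a ↦ ⟨_, (hg a _).2 rfl⟩)
      (connectedComponentMk_r (M := M.swap) hg) a, show M.swap.quad = Γ.quad from hquad]
    rfl
  exists_eq_comp _ hφ := exists_eq_comp_of_mem (M := M.swap) hg hb hφ
  comp_mem f := comp_connectedComponentMk_mem (M := M.swap) hg hb f

end CombinatorialMap

theorem theorem2p2 {X : Type*} [Finite X] (Γ : CombinatorialMap X) :
    ∃ D : DeltaMatroid Γ.Quad, (∀ F : Set Γ.Quad, D.Feasible F ↔ Γ.IsFeasible F) ∧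
      D.lower.IsCycleMatroidOf Γ.graph ∧ D.upper.IsCocycleMatroidOf Γ.dualGraph := by
  obtain ⟨M, hquad, hr, hg, hb⟩ := Γ.exists_flagSystem
  exact ⟨M.deltaMatroid, fun F ↦ (CombinatorialMap.isFeasible_iff hquad hr hg hb F).symm,
    (CombinatorialMap.isGraph_graph hquad hr hb).lower_isCycleMatroidOf fun _ ↦ Iff.rfl,
    (CombinatorialMap.isGraph_dualGraph hquad hg hb).upper_isCocycleMatroidOf⟩
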